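/- Let $n\ge 1$ and $r\ge 1$ be integers. A schedule for problems $0,\dots,n-1$ on a single processor is an infinite sequence of executions of contracts: each execution is assigned to one problem, has a positive length, and the executions are carried out one after the other from time $0$ on without overlapping (idle time is allowed). With redundancy parameter $r$, a contract (a problem together with a length) is usable at time $t$ if it has been executed to completion at least $r$ times by time $t$. Let $\ell_{i,t}$ be the length of the longest contract for problem $i$ that is usable at time $t$ ($\ell_{i,t}=0$ if there is none). The acceleration ratio of the schedule is $$\beta=\sup_{t}\ \max_{0\le i\le n-1}\ \frac{t}{\ell_{i,t}},$$ where $t$ ranges over the times at which every problem has a usable contract, and $\beta=\infty$ if there is no such time. The pseudo-exponential schedule with base $b>1$ proceeds in phases $i=0,1,2,\dots$, without idle time: in phase $i$ it executes $r$ contracts of length $b^i$ for problem $i \bmod n$. Theorem. The pseudo-exponential schedule with base $b=\frac{n+1}{n}$ has acceleration ratio at most $$ r\,n\left(\frac{n+1}{n}\right)^{n+1}.$$ Furthermore, this acceleration ratio is optimal: every schedule has acceleration ratio at least $r\,n\left(\frac{n+1}{n}\right)^{n+1}$. -/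

import Mathlib

open scoped ENNReal

noncomputable section

/-- A schedule of contract executions for the problems `0, …, n-1` on a single processor:
the `k`-th execution is for problem `problem k`, has length `length k > 0`, and occupies the
time interval from `start k` to `start k + length k`. Executions do not overlap;
the processor may idle between them. -/
structure ContractSchedule (n : ℕ) where
  problem : ℕ → Fin n
  length : ℕ → ℝ
  start : ℕ → ℝ
  length_pos : ∀ k, 0 < length k
  start_zero_nonneg : 0 ≤ start 0
  start_succ : ∀ k, start k + length k ≤ start (k + 1)

namespace ContractSchedule

variable {n : ℕ}

/-- The time at which the `k`-th execution is completed. -/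
def finish (S : ContractSchedule n) (k : ℕ) : ℝ := S.start k + S.length k

/-- The executions of the contract of length `L` for problem `i` completed by time `t`. -/
def completed (S : ContractSchedule n) (i : Fin n) (L t : ℝ) : Set ℕ :=
  {k | S.problem k = i ∧ S.length k = L ∧ S.finish k ≤ t}

/-- The length `ℓ_{i,t}` of the longest contract for problem `i` that has been executed
(to completion) at least `r` times by time `t`; it is `0` if there is no such contract. -/
def usableLength (S : ContractSchedule n) (r : ℕ) (i : Fin n) (t : ℝ) : ℝ :=
  sSup {L : ℝ | (r : ℕ∞) ≤ (S.completed i L t).encard}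

/-- The interruption times at which every problem has a usable contract. -/
def interruptionTimes (S : ContractSchedule n) (r : ℕ) : Set ℝ :=
  {t | ∀ i, 0 < S.usableLength r i t}

open Classical in
/-- The acceleration ratio `sup_{t, i} t / ℓ_{i,t}` with redundancy parameter `r`. As usual,
interruptions are considered once every problem has a usable contract; if some problem never
gets one, then the ratio is infinite. -/
def accelerationRatio (S : ContractSchedule n) (r : ℕ) : ℝ≥0∞ :=
  if (S.interruptionTimes r).Nonempty then
    ⨆ t ∈ S.interruptionTimes r, ⨆ i : Fin n, ENNReal.ofReal (t / S.usableLength r i t)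
  else ⊤

/-- The pseudo-exponential schedule with base `b`: in phase `i = 0, 1, 2, …`, it executes,
without idling, `r` contracts of length `b ^ i` for problem `i mod n`. Thus the `k`-th execution
belongs to phase `k / r` (integer division). -/
def pseudoExponential (n r : ℕ) (hn : 0 < n) (b : ℝ) (hb : 1 < b) : ContractSchedule n where
  problem k := ⟨(k / r) % n, Nat.mod_lt _ hn⟩
  length k := b ^ (k / r)
  start k := ∑ j ∈ Finset.range k, b ^ (j / r)
  length_pos k := pow_pos (one_pos.trans hb) _
  start_zero_nonneg := by simp
  start_succ k := by rw [Finset.sum_range_succ]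

end ContractSchedule

theorem one_lt_succ_div_self {n : ℕ} (hn : 0 < n) : (1 : ℝ) < ((n : ℝ) + 1) / n := by
  have h : (0 : ℝ) < n := by exact_mod_cast hn
  rw [lt_div_iff₀ h]
  linarith

end

/-! Lower bound: call an execution a record if it makes usable a longer contract than any before it
for its problem. If all ratios are at most `a` from `t₀` on, each problem has infinitely many
records. Just before the next record of its problem finishes, a record `e` is still the best usable
contract, so that finish time is at most `a * length e`. Each record also accounts for `r`
executions of its own contract, so `r` times the total length of the records so far is at most the
current finish time. Let `F k` be the finish time of the `k`-th record. Summing, the successors of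
the first `k + 1` records have total finish time at most `(a / r) * F k`. These successors and the
`n` first records are `k + 1 + n` distinct records, so the partial sums of `F`, shifted by a
constant, satisfy the recurrence of `le_of_forall_le_mul_sub`, which forces `a / r ≥ n * ((n + 1) /
n) ^ (n + 1)`. Upper bound: a geometric sum gives the end of each phase, and between consecutive
phases of a problem the ratio is at most `r * n * b ^ (n + 1)`. -/

/-! ### Growth inequalities for real sequences -/

/-- The sum of a monotone function over a finite set of natural numbers is at least its sum over
an initial segment of the same cardinality. -/
theorem sum_range_card_le_sum_of_monotone {F : ℕ → ℝ} (hF : Monotone F) (s : Finset ℕ) :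
    ∑ j ∈ Finset.range s.card, F j ≤ ∑ j ∈ s, F j := by
  induction s using Finset.induction_on_max with
  | empty => simp
  | insert a s ha ih =>
    have hna : a ∉ s := fun h => lt_irrefl _ (ha a h)
    have hcard : s.card ≤ a := by
      simpa using Finset.card_le_card
        (show s ⊆ Finset.range a from fun x hx => Finset.mem_range.2 (ha x hx))
    rw [Finset.card_insert_of_notMem hna, Finset.sum_range_succ, Finset.sum_insert hna, add_comm]
    exact add_le_add (hF hcard) ih

/-- Let `L` be the infimum of the ratios `S (k + 1) / S k`. Since `S` grows by at least `L ^ n` in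
`n` steps, the hypothesis bounds every ratio below by `μ / (μ - L ^ n)`. Hence so is `L`, that is,
`L ^ (n + 1) ≤ μ * (L - 1)`, and it remains to minimize `L ^ (n + 1) / (L - 1)`. -/
theorem le_of_forall_le_mul_sub {n : ℕ} (hn : 0 < n) {μ : ℝ} {S : ℕ → ℝ} (hpos : ∀ k, 0 < S k)
    (hmono : Monotone S) (h : ∀ k, S (k + 1 + n) ≤ μ * (S (k + 1) - S k)) :
    (n : ℝ) * (((n : ℝ) + 1) / n) ^ (n + 1) ≤ μ := by
  have hn' : (0 : ℝ) < n := by exact_mod_cast hn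
  set L : ℝ := ⨅ k, S (k + 1) / S k with hL
  have hone : ∀ k, 1 ≤ S (k + 1) / S k := fun k =>
    (one_le_div (hpos k)).2 (hmono (Nat.le_succ k))
  have hLle : ∀ k, L ≤ S (k + 1) / S k := fun k =>
    ciInf_le ⟨1, by rintro _ ⟨k, rfl⟩; exact hone k⟩ k
  have hL1 : 1 ≤ L := le_ciInf hone
  have hL0 : 0 < L := one_pos.trans_le hL1
  have hpow : ∀ k m, L ^ m * S k ≤ S (k + m) := by
    intro k m
    induction m with
    | zero => simp
    | succ m ih =>
      calc L ^ (m + 1) * S k = L * (L ^ m * S k) := by ring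
        _ ≤ L * S (k + m) := by gcongr
        _ ≤ S (k + m + 1) := (le_div_iff₀ (hpos _)).1 (hLle _)
  have hkey : ∀ k, μ * S k ≤ (μ - L ^ n) * S (k + 1) := fun k => by
    have := (hpow (k + 1) n).trans (h k)
    linarith
  have hμ : 0 < μ := by
    have h1 := (hpos _).trans_le (h 0)
    exact pos_of_mul_pos_left h1 (sub_nonneg.2 (hmono (Nat.le_succ 0)))
  have hd : 0 < μ - L ^ n :=
    pos_of_mul_pos_left ((mul_pos hμ (hpos 0)).trans_le (hkey 0)) (hpos _).le
  have hLge : μ / (μ - L ^ n) ≤ L := le_ciInf fun k => by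
    rw [div_le_div_iff₀ hd (hpos k), mul_comm (S (k + 1))]
    exact hkey k
  rw [div_le_iff₀ hd] at hLge
  have hmul : L ^ (n + 1) ≤ μ * (L - 1) := by rw [pow_succ]; linarith
  have hgt : 0 < L - 1 := pos_of_mul_pos_right ((pow_pos hL0 _).trans_le hmul) hμ.le
  -- Bernoulli's inequality at `n * L / (n + 1)`, with equality at the minimizer `L = (n + 1) / n`.
  have hbern : (n : ℝ) * (L - 1) ≤ (n * L / (n + 1)) ^ (n + 1) := by
    have h2 : (-2 : ℝ) ≤ n * L / (n + 1) - 1 := by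
      have : 0 ≤ (n : ℝ) * L / (n + 1) := by positivity
      linarith
    have h3 := one_add_mul_le_pow h2 (n + 1)
    rw [add_sub_cancel] at h3
    refine le_trans (le_of_eq ?_) h3
    push_cast
    field_simp
    ring
  refine le_of_mul_le_mul_right ?_ hgt
  calc (n : ℝ) * (((n : ℝ) + 1) / n) ^ (n + 1) * (L - 1)
      = (((n : ℝ) + 1) / n) ^ (n + 1) * (n * (L - 1)) := by ring
    _ ≤ (((n : ℝ) + 1) / n) ^ (n + 1) * (n * L / (n + 1)) ^ (n + 1) := by gcongr
    _ = L ^ (n + 1) := by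
      rw [← mul_pow]
      congr 1
      field_simp
    _ ≤ μ * (L - 1) := hmul

/-- The values of `next` on `0, …, k` and those of `first` are `k + 1 + n` distinct indices, so the
sum of `F` over them dominates the initial sum of that many terms. The values of `first` contribute
only the constant `C`. -/
theorem le_of_forall_sum_successor_le {n : ℕ} (hn : 0 < n) {μ : ℝ} {F : ℕ → ℝ} (hF : Monotone F)
    (hF0 : 0 < F 0) {next : ℕ → ℕ} (hnext : next.Injective) {first : Fin n → ℕ}
    (hfirst : first.Injective) (hne : ∀ i j, first i ≠ next j)
    (h : ∀ k, ∑ j ∈ Finset.range (k + 1), F (next j) ≤ μ * F k) :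
    (n : ℝ) * (((n : ℝ) + 1) / n) ^ (n + 1) ≤ μ := by
  classical
  have hFpos : ∀ k, 0 < F k := fun k => hF0.trans_le (hF (Nat.zero_le k))
  set C : ℝ := ∑ i, F (first i)
  have hsum : ∀ k, ∑ j ∈ Finset.range (k + 1 + n), F j - C ≤ μ * F k := by
    intro k
    have hdisj : Disjoint ((Finset.range (k + 1)).image next) (Finset.univ.image first) := by
      rw [Finset.disjoint_left]
      intro x hx hx'
      obtain ⟨j, -, rfl⟩ := Finset.mem_image.1 hx
      obtain ⟨i, -, hi⟩ := Finset.mem_image.1 hx'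
      exact hne i j hi
    have h1 := sum_range_card_le_sum_of_monotone hF
      ((Finset.range (k + 1)).image next ∪ Finset.univ.image first)
    rw [Finset.card_union_of_disjoint hdisj, Finset.card_image_of_injective _ hnext,
      Finset.card_image_of_injective _ hfirst, Finset.card_range, Finset.card_univ,
      Fintype.card_fin, Finset.sum_union hdisj, Finset.sum_image hnext.injOn,
      Finset.sum_image hfirst.injOn] at h1
    linarith [h k]
  -- Starting the partial sums at index `K` keeps them positive after subtracting `C`.
  obtain ⟨K, hK⟩ := exists_nat_gt (C / F 0)
  rw [div_lt_iff₀ hF0] at hK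
  have hlarge : ∀ m : ℕ, (m : ℝ) * F 0 ≤ ∑ j ∈ Finset.range m, F j := fun m => by
    simpa using Finset.card_nsmul_le_sum (Finset.range m) F (F 0) fun j _ => hF (Nat.zero_le j)
  have hmono : Monotone fun k => ∑ j ∈ Finset.range (k + K), F j - C :=
    monotone_nat_of_le_succ fun k => by
      rw [show k + 1 + K = k + K + 1 by ring, Finset.sum_range_succ]
      linarith [hFpos (k + K)]
  refine le_of_forall_le_mul_sub hn (S := fun k => ∑ j ∈ Finset.range (k + K), F j - C)
    (fun k => lt_of_lt_of_le ?_ (hmono (Nat.zero_le k))) hmono fun k => ?_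
  · simpa using hK.trans_le (hlarge K)
  · rw [show k + 1 + n + K = (k + K) + 1 + n by ring, show k + 1 + K = k + K + 1 by ring,
      Finset.sum_range_succ _ (k + K)]
    convert hsum (k + K) using 2
    ring

namespace ContractSchedule

variable {n : ℕ} (S : ContractSchedule n) {r : ℕ}

/-! ### Usable contracts and records -/

theorem sum_length_le_start (k : ℕ) : ∑ j ∈ Finset.range k, S.length j ≤ S.start k := by
  induction k with
  | zero => simpa using S.start_zero_nonneg
  | succ k ih =>
    rw [Finset.sum_range_succ]
    linarith [S.start_succ k]

theorem start_nonneg (k : ℕ) : 0 ≤ S.start k :=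
  (Finset.sum_nonneg fun j _ => (S.length_pos j).le).trans (S.sum_length_le_start k)

theorem length_le_finish (k : ℕ) : S.length k ≤ S.finish k :=
  le_add_of_nonneg_left (S.start_nonneg k)

theorem finish_pos (k : ℕ) : 0 < S.finish k :=
  (S.length_pos k).trans_le (S.length_le_finish k)

theorem sum_length_le_finish (k : ℕ) :
    ∑ j ∈ Finset.range (k + 1), S.length j ≤ S.finish k := by
  rw [Finset.sum_range_succ]
  exact add_le_add_left (S.sum_length_le_start k) _

theorem finish_strictMono : StrictMono S.finish :=
  strictMono_nat_of_lt_succ fun k => by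
    have := S.length_pos (k + 1)
    have := S.start_succ k
    simp only [finish]
    linarith

/-- The executions among `0, …, k` of the same contract as the `k`-th execution. -/
noncomputable def repetitions (k : ℕ) : Finset ℕ :=
  (Finset.range (k + 1)).filter fun j => S.problem j = S.problem k ∧ S.length j = S.length k

variable (r) in
/-- The contract of the `k`-th execution is usable once that execution is completed. -/
def UsableAfter (k : ℕ) : Prop := r ≤ (S.repetitions k).card

variable (r) in
/-- The `k`-th execution makes usable a contract that is longer than all contracts for the same
problem that were usable before. -/
def IsRecord (k : ℕ) : Prop :=
  S.UsableAfter r k ∧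
    ∀ j < k, S.UsableAfter r j → S.problem j = S.problem k → S.length j < S.length k

/-- Among `r` completed executions of one contract, the latest has all of them among its
repetitions. -/
theorem exists_usableAfter_of_le_encard (hr : 0 < r) {i : Fin n} {L t : ℝ}
    (h : (r : ℕ∞) ≤ (S.completed i L t).encard) :
    ∃ k, S.UsableAfter r k ∧ S.problem k = i ∧ S.length k = L ∧ S.finish k ≤ t := by
  obtain ⟨s, hs, hcard⟩ := Set.exists_subset_encard_eq h
  have hfin : s.Finite := Set.finite_of_encard_eq_coe hcard
  lift s to Finset ℕ using hfin
  rw [Set.encard_coe_eq_coe_finsetCard, Nat.cast_inj] at hcard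
  have hne : s.Nonempty := Finset.card_pos.1 (hcard ▸ hr)
  obtain ⟨hp, hl, hf⟩ := hs (s.max'_mem hne)
  refine ⟨s.max' hne, ?_, hp, hl, hf⟩
  rw [UsableAfter, ← hcard]
  refine Finset.card_le_card fun j hj => ?_
  obtain ⟨hp', hl', -⟩ := hs hj
  exact Finset.mem_filter.2 ⟨Finset.mem_range.2 (Nat.lt_succ_of_le (s.le_max' j hj)),
    hp'.trans hp.symm, hl'.trans hl.symm⟩

theorem bddAbove_usable (hr : 0 < r) (i : Fin n) (t : ℝ) :
    BddAbove {L : ℝ | (r : ℕ∞) ≤ (S.completed i L t).encard} := by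
  refine ⟨t, fun L hL => ?_⟩
  obtain ⟨k, -, -, rfl, hk⟩ := S.exists_usableAfter_of_le_encard hr hL
  exact (S.length_le_finish k).trans hk

theorem le_usableLength (hr : 0 < r) {i : Fin n} {L t : ℝ}
    (h : (r : ℕ∞) ≤ (S.completed i L t).encard) : L ≤ S.usableLength r i t :=
  le_csSup (S.bddAbove_usable hr i t) h

theorem usableLength_le (hr : 0 < r) {i : Fin n} {t M : ℝ} (hM : 0 ≤ M)
    (h : ∀ k, S.UsableAfter r k → S.problem k = i → S.finish k ≤ t → S.length k ≤ M) :
    S.usableLength r i t ≤ M := by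
  refine Real.sSup_le (fun L hL => ?_) hM
  obtain ⟨k, hk, hp, rfl, hf⟩ := S.exists_usableAfter_of_le_encard hr hL
  exact h k hk hp hf

theorem usableLength_mono (hr : 0 < r) (i : Fin n) : Monotone (S.usableLength r i) := by
  intro t u htu
  have hnonneg : 0 ≤ S.usableLength r i u := by
    refine Real.sSup_nonneg fun L hL => ?_
    obtain ⟨k, -, -, rfl, -⟩ := S.exists_usableAfter_of_le_encard hr hL
    exact (S.length_pos k).le
  refine Real.sSup_le (fun L hL => S.le_usableLength hr (hL.trans ?_)) hnonneg
  exact Set.encard_le_encard fun k hk => ⟨hk.1, hk.2.1, hk.2.2.trans htu⟩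

theorem IsRecord.eq_of_contract_eq {S : ContractSchedule n} {e e' : ℕ} (h : S.IsRecord r e)
    (h' : S.IsRecord r e') (hp : S.problem e = S.problem e') (hl : S.length e = S.length e') :
    e = e' := by
  rcases lt_trichotomy e e' with hlt | heq | hlt
  · exact absurd hl (h'.2 e hlt h.1 hp).ne
  · exact heq
  · exact absurd hl (h.2 e' hlt h'.1 hp.symm).ne'

/-- Distinct records have distinct contracts, so their sets of repetitions are disjoint; each has at
least `r` members of the record's length. -/
theorem mul_sum_length_le_finish {s : Finset ℕ} {k : ℕ} (hs : ∀ e ∈ s, S.IsRecord r e)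
    (hk : ∀ e ∈ s, e ≤ k) : (r : ℝ) * ∑ e ∈ s, S.length e ≤ S.finish k := by
  refine le_trans ?_ (S.sum_length_le_finish k)
  have hdisj : (s : Set ℕ).PairwiseDisjoint S.repetitions := by
    intro e he e' he' hne
    refine Finset.disjoint_left.2 fun j hj hj' => hne ?_
    obtain ⟨-, hp, hl⟩ := Finset.mem_filter.1 hj
    obtain ⟨-, hp', hl'⟩ := Finset.mem_filter.1 hj'
    exact (hs e he).eq_of_contract_eq (hs e' he') (hp.symm.trans hp') (hl.symm.trans hl')
  calc (r : ℝ) * ∑ e ∈ s, S.length e = ∑ e ∈ s, (r : ℝ) * S.length e := Finset.mul_sum _ _ _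
    _ ≤ ∑ e ∈ s, ∑ j ∈ S.repetitions e, S.length j := by
      refine Finset.sum_le_sum fun e he => ?_
      rw [Finset.sum_congr rfl fun j hj => (Finset.mem_filter.1 hj).2.2, Finset.sum_const,
        nsmul_eq_mul]
      have : (r : ℝ) ≤ (S.repetitions e).card := by exact_mod_cast (hs e he).1
      exact mul_le_mul_of_nonneg_right this (S.length_pos e).le
    _ = ∑ j ∈ s.biUnion S.repetitions, S.length j := (Finset.sum_biUnion hdisj).symm
    _ ≤ ∑ j ∈ Finset.range (k + 1), S.length j := by
      refine Finset.sum_le_sum_of_subset_of_nonneg (fun j hj => ?_)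
        fun j _ _ => (S.length_pos j).le
      obtain ⟨e, he, hj⟩ := Finset.mem_biUnion.1 hj
      have h1 := Finset.mem_range.1 (Finset.mem_filter.1 hj).1
      have h2 := hk e he
      exact Finset.mem_range.2 (by omega)

/-- If a contract for problem `i` of length greater than `M` becomes usable, then the first one
to do so is a record. -/
theorem exists_isRecord_of_lt_length {i : Fin n} {M : ℝ} {k : ℕ} (hk : S.UsableAfter r k)
    (hp : S.problem k = i) (hM : M < S.length k) :
    ∃ m ≤ k, S.IsRecord r m ∧ S.problem m = i ∧ M < S.length m := by
  classical
  have hex : ∃ m, S.UsableAfter r m ∧ S.problem m = i ∧ M < S.length m := ⟨k, hk, hp, hM⟩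
  obtain ⟨h1, h2, h3⟩ := Nat.find_spec hex
  refine ⟨Nat.find hex, Nat.find_min' hex ⟨hk, hp, hM⟩, ⟨h1, fun j hj hu hpj => ?_⟩, h2, h3⟩
  by_contra! hle
  exact Nat.find_min hex hj ⟨hu, hpj.trans h2, h3.trans_le hle⟩

/-- Until the next record for the same problem, the contract of a record stays the longest
usable one. -/
theorem usableLength_le_length_of_isRecord (hr : 0 < r) {e e' : ℕ} (he : S.IsRecord r e)
    (hnext : ∀ m, S.IsRecord r m → S.problem m = S.problem e → e < m → e' ≤ m) {t : ℝ}
    (ht : t < S.finish e') : S.usableLength r (S.problem e) t ≤ S.length e := by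
  refine S.usableLength_le hr (S.length_pos e).le fun k hk hp hf => ?_
  by_contra! hlt
  obtain ⟨m, hmk, hm, hpm, hlm⟩ := S.exists_isRecord_of_lt_length hk hp hlt
  have hem : e < m := by
    rcases lt_trichotomy e m with h | rfl | h
    · exact h
    · exact absurd hlm (lt_irrefl _)
    · exact absurd hlm (he.2 m h hm.1 hpm).not_gt
  have h1 : S.finish e' ≤ S.finish k :=
    S.finish_strictMono.monotone ((hnext m hm hpm hem).trans hmk)
  linarith

/-! ### The lower bound -/

theorem exists_isRecord_gt (hr : 0 < r) {a t₀ : ℝ}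
    (h : ∀ t, t₀ ≤ t → ∀ i, t ≤ a * S.usableLength r i t) (ha : 0 < a) (i : Fin n) (N : ℕ) :
    ∃ m > N, S.IsRecord r m ∧ S.problem m = i ∧ t₀ < S.finish m := by
  -- A contract longer than `M` can only finish after both `t₀` and the `N`-th execution. If no
  -- usable one were that long, the ratio would exceed `a` at time `a * M + 1` or later.
  set M : ℝ := |t₀| + S.finish N with hMdef
  have hM : 0 < M := add_pos_of_nonneg_of_pos (abs_nonneg _) (S.finish_pos N)
  have hex : ∃ k, S.UsableAfter r k ∧ S.problem k = i ∧ M < S.length k := by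
    by_contra! hcon
    have h1 := h (max t₀ (a * M + 1)) (le_max_left _ _) i
    have h2 : S.usableLength r i (max t₀ (a * M + 1)) ≤ M :=
      S.usableLength_le hr hM.le fun k hk hp _ => hcon k hk hp
    have h3 := mul_le_mul_of_nonneg_left h2 ha.le
    linarith [le_max_right t₀ (a * M + 1)]
  obtain ⟨k, hk, hp, hl⟩ := hex
  obtain ⟨m, -, hm, hpm, hlm⟩ := S.exists_isRecord_of_lt_length hk hp hl
  have hfin := hlm.trans_le (S.length_le_finish m)
  refine ⟨m, S.finish_strictMono.lt_iff_lt.1 ?_, hm, hpm, ?_⟩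
  · linarith [abs_nonneg t₀]
  · linarith [le_abs_self t₀, S.finish_pos N]

/-- The lower bound on the acceleration ratio, for a schedule whose ratios are at most `a`
from time `t₀` on. -/
theorem mul_pow_le_of_forall_le (hn : 0 < n) (hr : 0 < r) {a t₀ : ℝ}
    (h : ∀ t, t₀ ≤ t → ∀ i, t ≤ a * S.usableLength r i t) (ha : 0 < a) :
    (r : ℝ) * n * (((n : ℝ) + 1) / n) ^ (n + 1) ≤ a := by
  classical
  have hr' : (0 : ℝ) < r := by exact_mod_cast hr
  let R : ℕ → Prop := fun m => S.IsRecord r m ∧ t₀ < S.finish m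
  have hgt : ∀ i N, ∃ m, R m ∧ S.problem m = i ∧ N < m := fun i N => by
    obtain ⟨m, hm, h1, h2, h3⟩ := S.exists_isRecord_gt hr h ha i N
    exact ⟨m, ⟨h1, h3⟩, h2, hm⟩
  have hinf : {m | R m}.Infinite := Set.infinite_of_not_bddAbove fun ⟨N, hN⟩ => by
    obtain ⟨m, hm, -, hlt⟩ := hgt ⟨0, hn⟩ N
    exact absurd (hN hm) hlt.not_ge
  have hfirst : ∀ i, ∃ f, R f ∧ S.problem f = i ∧ ∀ m, R m → S.problem m = i → f ≤ m := by
    intro i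
    have hex : ∃ m, R m ∧ S.problem m = i :=
      let ⟨m, h1, h2, _⟩ := hgt i 0
      ⟨m, h1, h2⟩
    exact ⟨Nat.find hex, (Nat.find_spec hex).1, (Nat.find_spec hex).2,
      fun m h1 h2 => Nat.find_min' hex ⟨h1, h2⟩⟩
  have hnext : ∀ e, ∃ e', (R e' ∧ S.problem e' = S.problem e ∧ e < e') ∧
      ∀ m, R m → S.problem m = S.problem e → e < m → e' ≤ m := fun e =>
    ⟨Nat.find (hgt (S.problem e) e), Nat.find_spec (hgt (S.problem e) e),
      fun m h1 h2 h3 => Nat.find_min' _ ⟨h1, h2, h3⟩⟩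
  choose first hfR hfp hfmin using hfirst
  choose next hnspec hnmin using hnext
  have hnth : ∀ k, R (Nat.nth R k) := Nat.nth_mem_of_infinite hinf
  have hnthmono := Nat.nth_strictMono hinf
  have hcount : ∀ {e}, R e → Nat.nth R (Nat.count R e) = e := fun h => Nat.nth_count h
  have hnextle : ∀ e, R e → S.finish (next e) ≤ a * S.length e := fun e he => by
    -- At its finish time the new record may already count, so the bound is taken at earlier times
    -- and passed to the limit.
    refine le_of_forall_lt_imp_le_of_dense fun t ht => ?_
    have h1 : max t t₀ < S.finish (next e) := max_lt ht (hnspec e).1.2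
    refine (le_max_left t t₀).trans ((h _ (le_max_right t t₀) (S.problem e)).trans ?_)
    refine mul_le_mul_of_nonneg_left ?_ ha.le
    refine S.usableLength_le_length_of_isRecord hr he.1 (fun m hm hp hlt => ?_) h1
    exact hnmin e m ⟨hm, he.2.trans (S.finish_strictMono hlt)⟩ hp hlt
  have hfin := le_of_forall_sum_successor_le hn (μ := a / r)
    (F := fun k => S.finish (Nat.nth R k))
    (S.finish_strictMono.monotone.comp hnthmono.monotone) (S.finish_pos _)
    (next := fun k => Nat.count R (next (Nat.nth R k)))
    (first := fun i => Nat.count R (first i)) ?_ ?_ ?_ ?_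
  · rw [le_div_iff₀ hr'] at hfin
    linarith
  · intro j k hjk
    have h1 : next (Nat.nth R j) = next (Nat.nth R k) := by
      rw [← hcount (hnspec (Nat.nth R j)).1, ← hcount (hnspec (Nat.nth R k)).1]
      exact congrArg _ hjk
    have hp : S.problem (Nat.nth R j) = S.problem (Nat.nth R k) := by
      rw [← (hnspec (Nat.nth R j)).2.1, ← (hnspec (Nat.nth R k)).2.1, h1]
    refine hnthmono.injective ?_
    -- Of two records of the same problem, the earlier has its successor no later than the other
    -- record, hence strictly before that record's successor.
    rcases lt_trichotomy (Nat.nth R j) (Nat.nth R k) with hlt | heq | hlt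
    · have h2 := hnmin _ _ (hnth k) hp.symm hlt
      have h3 := (hnspec (Nat.nth R k)).2.2
      omega
    · exact heq
    · have h2 := hnmin _ _ (hnth j) hp hlt
      have h3 := (hnspec (Nat.nth R j)).2.2
      omega
  · intro i i' hii
    rw [← hfp i, ← hfp i', ← hcount (hfR i), ← hcount (hfR i')]
    exact congrArg _ (congrArg _ hii)
  · intro i j hij
    have h1 : first i = next (Nat.nth R j) := by
      rw [← hcount (hfR i), ← hcount (hnspec (Nat.nth R j)).1]
      exact congrArg _ hij
    have hp : S.problem (Nat.nth R j) = i := by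
      rw [← hfp i, h1, (hnspec (Nat.nth R j)).2.1]
    have h2 := hfmin i _ (hnth j) hp
    have h3 := (hnspec (Nat.nth R j)).2.2
    omega
  · intro k
    have h1 := S.mul_sum_length_le_finish (r := r) (k := Nat.nth R k)
      (s := (Finset.range (k + 1)).image (Nat.nth R))
      (fun e he => by
        obtain ⟨j, -, rfl⟩ := Finset.mem_image.1 he
        exact (hnth j).1)
      (fun e he => by
        obtain ⟨j, hj, rfl⟩ := Finset.mem_image.1 he
        exact hnthmono.monotone (Nat.lt_succ_iff.1 (Finset.mem_range.1 hj)))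
    rw [Finset.sum_image hnthmono.injective.injOn] at h1
    calc ∑ j ∈ Finset.range (k + 1), S.finish (Nat.nth R (Nat.count R (next (Nat.nth R j))))
        ≤ ∑ j ∈ Finset.range (k + 1), a * S.length (Nat.nth R j) :=
          Finset.sum_le_sum fun j _ => by
            rw [hcount (hnspec (Nat.nth R j)).1]
            exact hnextle _ (hnth j)
      _ = a / r * (r * ∑ j ∈ Finset.range (k + 1), S.length (Nat.nth R j)) := by
          rw [← Finset.mul_sum]
          field_simp
      _ ≤ a / r * S.finish (Nat.nth R k) := by gcongr

theorem ofReal_le_accelerationRatio (hn : 0 < n) (hr : 0 < r) :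
    ENNReal.ofReal ((r : ℝ) * n * (((n : ℝ) + 1) / n) ^ (n + 1)) ≤ S.accelerationRatio r := by
  by_cases htop : S.accelerationRatio r = ⊤
  · simp [htop]
  have hne : (S.interruptionTimes r).Nonempty := by
    by_contra hne
    exact htop (if_neg hne)
  obtain ⟨t₀, ht₀⟩ := hne
  have hdef : S.accelerationRatio r = ⨆ t ∈ S.interruptionTimes r, ⨆ i : Fin n,
      ENNReal.ofReal (t / S.usableLength r i t) := if_pos ⟨t₀, ht₀⟩
  have hbound : ∀ t, t₀ ≤ t → ∀ i,
      t ≤ (S.accelerationRatio r).toReal * S.usableLength r i t := by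
    intro t ht i
    have hmem : t ∈ S.interruptionTimes r := fun i => (ht₀ i).trans_le (S.usableLength_mono hr i ht)
    rw [← div_le_iff₀ (hmem i)]
    refine (ENNReal.ofReal_le_iff_le_toReal htop).1 ?_
    rw [hdef]
    exact le_iSup₂_of_le t hmem (le_iSup_of_le i le_rfl)
  have ha : 0 < (S.accelerationRatio r).toReal := by
    have h1 := hbound (max t₀ 1) (le_max_left _ _) ⟨0, hn⟩
    have h2 := (ht₀ ⟨0, hn⟩).trans_le (S.usableLength_mono hr _ (le_max_left t₀ 1))
    exact pos_of_mul_pos_left (one_pos.trans_le ((le_max_right t₀ 1).trans h1)) h2.le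
  rw [ENNReal.ofReal_le_iff_le_toReal htop]
  exact S.mul_pow_le_of_forall_le hn hr hbound ha

/-! ### The pseudo-exponential schedule -/

theorem sum_range_mul_pow_div (hr : 0 < r) (b : ℝ) (m : ℕ) :
    ∑ j ∈ Finset.range (m * r), b ^ (j / r) = r * ∑ q ∈ Finset.range m, b ^ q := by
  induction m with
  | zero => simp
  | succ m ih =>
    rw [Nat.succ_mul, Finset.sum_range_add, ih, Finset.sum_range_succ, mul_add]
    congr 1
    rw [Finset.sum_congr rfl fun j hj => ?_, Finset.sum_const, Finset.card_range, nsmul_eq_mul]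
    rw [mul_comm m r, Nat.mul_add_div hr, Nat.div_eq_of_lt (Finset.mem_range.1 hj), add_zero]

theorem pow_le_usableLength_pseudoExponential (hn : 0 < n) (hr : 0 < r) {b : ℝ} (hb : 1 < b)
    {q : ℕ} {i : Fin n} (hq : q % n = i) {t : ℝ} (ht : r * ∑ p ∈ Finset.range (q + 1), b ^ p ≤ t) :
    b ^ q ≤ (pseudoExponential n r hn b hb).usableLength r i t := by
  refine le_usableLength _ hr ?_
  have hsub : (Finset.Ico (q * r) ((q + 1) * r) : Set ℕ) ⊆
      (pseudoExponential n r hn b hb).completed i (b ^ q) t := by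
    intro k hk
    rw [Finset.coe_Ico, Set.mem_Ico] at hk
    have hdiv : k / r = q := Nat.div_eq_of_lt_le hk.1 hk.2
    refine ⟨Fin.ext ?_, ?_, ?_⟩
    · simp [pseudoExponential, hdiv, hq]
    · simp [pseudoExponential, hdiv]
    · refine le_trans ?_ ht
      rw [← sum_range_mul_pow_div hr]
      simp only [finish, pseudoExponential]
      rw [← Finset.sum_range_succ]
      exact Finset.sum_le_sum_of_subset_of_nonneg (Finset.range_mono hk.2)
        fun j _ _ => (pow_pos (one_pos.trans hb) _).le
  refine le_trans (le_of_eq ?_) (Set.encard_le_encard hsub)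
  rw [Set.encard_coe_eq_coe_finsetCard, Nat.card_Ico, Nat.succ_mul, Nat.add_sub_cancel_left]

theorem one_le_usableLength_pseudoExponential (hn : 0 < n) (hr : 0 < r) {b : ℝ} (hb : 1 < b)
    {i : Fin n} {t : ℝ} (h : 0 < (pseudoExponential n r hn b hb).usableLength r i t) :
    1 ≤ (pseudoExponential n r hn b hb).usableLength r i t := by
  obtain ⟨L, hL⟩ : {L : ℝ | (r : ℕ∞) ≤
      ((pseudoExponential n r hn b hb).completed i L t).encard}.Nonempty := by
    by_contra hne
    rw [Set.not_nonempty_iff_eq_empty] at hne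
    rw [usableLength, hne, Real.sSup_empty] at h
    exact lt_irrefl _ h
  refine le_trans ?_ (le_usableLength _ hr hL)
  obtain ⟨k, -, -, rfl, -⟩ := exists_usableAfter_of_le_encard _ hr hL
  exact one_le_pow₀ hb.le

theorem accelerationRatio_pseudoExponential_le (hn : 0 < n) (hr : 0 < r) :
    (pseudoExponential n r hn (((n : ℝ) + 1) / n) (one_lt_succ_div_self hn)).accelerationRatio r
      ≤ ENNReal.ofReal ((r : ℝ) * n * (((n : ℝ) + 1) / n) ^ (n + 1)) := by
  set b : ℝ := ((n : ℝ) + 1) / n with hbdef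
  have hb : 1 < b := one_lt_succ_div_self hn
  have hb0 : 0 < b := one_pos.trans hb
  have hn' : (0 : ℝ) < n := by exact_mod_cast hn
  have hr' : (0 : ℝ) < r := by exact_mod_cast hr
  have hgeom : ∀ m, ∑ p ∈ Finset.range m, b ^ p = n * (b ^ m - 1) := fun m => by
    rw [geom_sum_eq hb.ne', show b - 1 = 1 / n by rw [hbdef]; field_simp; ring]
    field_simp
  have husable : ∀ (q : ℕ) (i : Fin n) (t : ℝ), q % n = i → r * (n * (b ^ (q + 1) - 1)) ≤ t →
      b ^ q ≤ (pseudoExponential n r hn b hb).usableLength r i t := fun q i t hq ht =>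
    pow_le_usableLength_pseudoExponential hn hr hb hq (by rwa [hgeom])
  have hne : ((pseudoExponential n r hn b hb).interruptionTimes r).Nonempty := by
    refine ⟨r * (n * (b ^ n - 1)), fun i => (pow_pos hb0 i).trans_le
      (husable i i _ (Nat.mod_eq_of_lt i.2) ?_)⟩
    have : b ^ ((i : ℕ) + 1) ≤ b ^ n := pow_le_pow_right₀ hb.le i.2
    gcongr
  rw [accelerationRatio, if_pos hne]
  refine iSup₂_le fun t ht => iSup_le fun i => ENNReal.ofReal_le_ofReal ?_
  rw [div_le_iff₀ (ht i)]
  -- The bound is the completion time of phase `i + s * n`; the least such `s` gives the first phase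
  -- of problem `i` unfinished at time `t`.
  have hex : ∃ s : ℕ, t < r * (n * (b ^ (i + s * n + 1) - 1)) := by
    obtain ⟨s, hs⟩ := pow_unbounded_of_one_lt (t / (r * n) + 1) hb
    refine ⟨s, ?_⟩
    have h1 : b ^ s ≤ b ^ ((i : ℕ) + s * n + 1) :=
      pow_le_pow_right₀ hb.le (by nlinarith)
    have h2 : t / (r * n) < b ^ ((i : ℕ) + s * n + 1) - 1 := by linarith
    rw [div_lt_iff₀ (by positivity)] at h2
    linarith
  classical
  have hlt := Nat.find_spec hex
  rcases hs : Nat.find hex with _ | s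
  -- With no earlier phase of problem `i` to use, the crude bound `1 ≤ ℓ` suffices because `i < n`.
  · rw [hs] at hlt
    have h1 : b ^ ((i : ℕ) + 0 * n + 1) ≤ b ^ (n + 1) :=
      pow_le_pow_right₀ hb.le (by have := i.2; omega)
    have h2 := one_le_usableLength_pseudoExponential hn hr hb (ht i)
    calc t ≤ r * n * b ^ (n + 1) := by
          refine hlt.le.trans ?_
          rw [mul_assoc]
          gcongr
          linarith
      _ ≤ _ := le_mul_of_one_le_right (by positivity) h2
  · rw [hs] at hlt
    have hle := not_lt.1 (Nat.find_min hex (m := s) (by omega))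
    have h2 := husable (i + s * n) i t
      (by rw [Nat.add_mul_mod_self_right, Nat.mod_eq_of_lt i.2]) hle
    calc t ≤ r * n * b ^ (n + 1) * b ^ ((i : ℕ) + s * n) := by
          refine hlt.le.trans ?_
          rw [mul_assoc, mul_assoc, ← pow_add,
            show (i : ℕ) + (s + 1) * n + 1 = n + 1 + (i + s * n) by ring]
          gcongr
          linarith
      _ ≤ _ := by gcongr

end ContractSchedule

theorem mainTheorem1 (n r : ℕ) (hn : 0 < n) (hr : 0 < r) :
    (ContractSchedule.pseudoExponential n r hn (((n : ℝ) + 1) / n)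
        (one_lt_succ_div_self hn)).accelerationRatio r
      ≤ ENNReal.ofReal ((r : ℝ) * n * (((n : ℝ) + 1) / n) ^ (n + 1)) ∧
    ∀ S : ContractSchedule n,
      ENNReal.ofReal ((r : ℝ) * n * (((n : ℝ) + 1) / n) ^ (n + 1)) ≤ S.accelerationRatio r :=
  ⟨ContractSchedule.accelerationRatio_pseudoExponential_le hn hr,
    fun S => S.ofReal_le_accelerationRatio hn hr⟩
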